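/- Let $\phi=\{x_1,x_2,\ldots\}\subset\mathbb{R}^2$ be a (homogeneous) Poisson point process of density $\lambda\in(0,\infty)$, the positions of the nodes. In each time slot $n$ every node transmits with probability $p\in(0,1]$, independently over nodes and slots (ALOHA); let $\phi_n\subset\phi$ be the set of nodes transmitting in slot $n$. Let $h_{xz}(n)\ge 0$ be the power fading coefficient between the node $x\in\phi$ and the location $z\in\mathbb{R}^2$ in slot $n$; these coefficients are independent over nodes, locations and slots and identically distributed (as $h$), with $\mathbb{E}[h]=1$ and $\mathbb{E}[h^2]<\infty$. Positions, transmission decisions and fading are mutually independent. Let the path loss $g:\mathbb{R}^2\to[0,\infty)$ depend only on $\|x\|$, be non-increasing in $\|x\|$, satisfy $\int_0^\infty r\,g(r)\,\mathrm{d}r<\infty$ (where $g(r)$ denotes the value of $g$ at distance $r$ from the origin), and be positive at some point other than the origin. The interference at location $z$ in slot $n$ is \[ I_n(z)=\sum_{x\in\phi}\mathbf{1}(x\in\phi_n)\,h_{xz}(n)\,g(x-z). \] Then the series defining $I_n(z)$ converges almost surely, $I_n(z)$ has a finite second moment and positive variance for all $n$ and $z$, and for all slots $k\neq l$ and all locations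 $u,v\in\mathbb{R}^2$ the correlation coefficient \[ \zeta(u,v)=\frac{\operatorname{Cov}(I_k(u),I_l(v))}{\sqrt{\operatorname{Var}I_k(u)}\,\sqrt{\operatorname{Var}I_l(v)}} \] equals \[ \zeta(u,v)=\frac{p\int_{\mathbb{R}^2}g(x)\,g(x-\|u-v\|)\,\mathrm{d}x}{\mathbb{E}[h^2]\int_{\mathbb{R}^2}g^2(x)\,\mathrm{d}x}, \] where $x-\|u-v\|$ stands for $x-(\|u-v\|,0)$, and where both integrals are finite and $\int_{\mathbb{R}^2}g^2(x)\,\mathrm{d}x>0$. -/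

import Mathlib

open MeasureTheory ProbabilityTheory
open scoped ENNReal NNReal

noncomputable section

/-- The Euclidean plane. -/
abbrev Plane : Type := EuclideanSpace ℝ (Fin 2)

/-- Number of points of the random sequence `X 0, X 1, …` lying in the set `B`. -/
def pointCount {Ω E : Type*} (X : ℕ → Ω → E) (B : Set E) (ω : Ω) : ℕ∞ :=
  {i : ℕ | X i ω ∈ B}.encard

/-- The random points `X 0, X 1, …` form a Poisson point process with intensity measure `μ`:
the number of points in a measurable set `B` of finite intensity is Poisson with mean `μ B`,
and the numbers of points in pairwise disjoint such sets are independent. -/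
structure IsPoissonPointProcess {Ω E : Type*} [MeasurableSpace Ω] [MeasurableSpace E]
    (μ : Measure E) (X : ℕ → Ω → E) (P : Measure Ω) : Prop where
  measurable : ∀ i, Measurable (X i)
  count_law : ∀ B : Set E, MeasurableSet B → μ B ≠ ∞ →
    HasLaw (pointCount X B) ((poissonMeasure (μ B).toNNReal).map (fun n : ℕ => (n : ℕ∞))) P
  count_indep : ∀ (n : ℕ) (B : Fin n → Set E), (∀ j, MeasurableSet (B j)) → (∀ j, μ (B j) ≠ ∞) →
    Pairwise (fun i j => Disjoint (B i) (B j)) → iIndepFun (fun j => pointCount X (B j)) P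

/-- A (large scale) path loss function on the plane: nonnegative, a function of the distance to the
origin only, decreasing in that distance, and with `∫₀^∞ r g(r) dr < ∞`, where `g(r)` is the value
of `g` at distance `r` from the origin. -/
structure IsPathLoss (g : Plane → ℝ) : Prop where
  nonneg : ∀ x, 0 ≤ g x
  radial : ∀ x y, ‖x‖ = ‖y‖ → g x = g y
  antitone : ∀ x y, ‖x‖ ≤ ‖y‖ → g y ≤ g x
  integrable : IntegrableOn (fun r : ℝ => r * g (EuclideanSpace.single 0 r)) (Set.Ioi 0)

/-- The random data of an ALOHA ad hoc network on the plane.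
* `X i` is the position of node `i`; the positions form a Poisson point process of density `lam`;
* `T i n` says whether node `i` transmits in time slot `n`, which has probability `p`;
* `h i z n` is the power fading coefficient between node `i` and the location `z` in slot `n`; all
  of them have the same law `ν`, a law on `[0, ∞)` with mean one and finite second moment;
* the transmission decisions are independent over nodes and slots, the fading coefficients are
  independent over nodes, locations and slots, and positions, decisions and fading are mutually
  independent. -/
structure IsAlohaNetwork {Ω : Type*} [MeasurableSpace Ω] (lam : ℝ≥0) (p : ℝ) (ν : Measure ℝ)
    (X : ℕ → Ω → Plane) (T : ℕ → ℕ → Ω → Bool) (h : ℕ → Plane → ℕ → Ω → ℝ)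
    (P : Measure Ω) : Prop where
  ppp : IsPoissonPointProcess (lam • (volume : Measure Plane)) X P
  transmit_measurable : ∀ i n, Measurable (T i n)
  transmit_prob : ∀ i n, P.real {ω | T i n ω = true} = p
  transmit_indep : iIndepFun (fun a : ℕ × ℕ => T a.1 a.2) P
  fading_measurable : ∀ i z n, Measurable (h i z n)
  fading_law : ∀ i z n, HasLaw (h i z n) ν P
  fading_nonneg : ∀ᵐ t ∂ν, 0 ≤ t
  fading_mean : ∫ t, t ∂ν = 1
  fading_sq : Integrable (fun t : ℝ => t ^ 2) ν
  fading_indep : iIndepFun (fun a : ℕ × Plane × ℕ => h a.1 a.2.1 a.2.2) P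
  indep_transmit_fading :
    IndepFun (fun ω i n => T i n ω) (fun ω i z n => h i z n ω) P
  indep_position_marks :
    IndepFun (fun ω i => X i ω) (fun ω => (fun i n => T i n ω, fun i z n => h i z n ω)) P

/-- Contribution of node `i` to the interference at location `z` in slot `n`. -/
def interferenceTerm {Ω : Type*} (g : Plane → ℝ) (X : ℕ → Ω → Plane) (T : ℕ → ℕ → Ω → Bool)
    (h : ℕ → Plane → ℕ → Ω → ℝ) (n : ℕ) (z : Plane) (i : ℕ) (ω : Ω) : ℝ :=
  if T i n ω = true then h i z n ω * g (X i ω - z) else 0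

/-- The interference at location `z` in slot `n`. -/
def interference {Ω : Type*} (g : Plane → ℝ) (X : ℕ → Ω → Plane) (T : ℕ → ℕ → Ω → Bool)
    (h : ℕ → Plane → ℕ → Ω → ℝ) (n : ℕ) (z : Plane) (ω : Ω) : ℝ :=
  ∑' i, interferenceTerm g X T h n z i ω

/-- The (Pearson) correlation coefficient of two real random variables. -/
def corrCoeff {Ω : Type*} [MeasurableSpace Ω] (Y Z : Ω → ℝ) (P : Measure Ω) : ℝ :=
  cov[Y, Z; P] / (Real.sqrt (Var[Y; P]) * Real.sqrt (Var[Z; P]))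

end

/-! Expand E[I_k(u) I_l(v)] as a double sum over nodes i, j and separate i ≠ j from i = j. For a
Poisson process the second factorial moment measure is the product of the intensity with itself
(`prod_eq_sum_map`), and the marks of two distinct nodes always have mean product p², even in one
slot. The off-diagonal part is therefore exactly the product of the means, and the covariance is the
diagonal part alone: λ ∫ g(x-u) g(x-v) dx times the mixed moment of the two marks of a single node
(`covariance_interference`). That moment is p² for different slots, since only the position is
shared, and p E[h²] for the same slot and location. In the quotient λ and one factor p cancel, and a
plane isometry brings the numerator to its stated form.

The factorial moment measure comes from E[N(A)N(B)] = μ(A)μ(B) + μ(A ∩ B)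
(`lintegral_pointCount_mul`) and uniqueness of product measures. Moments are computed in [0,∞],
where sums and integrals commute freely; finite moments then allow the return to real values. -/

/-! ### Moments of the Poisson distribution -/

/-- The Stein–Chen identity. -/
lemma lintegral_natCast_mul_poissonMeasure (r : ℝ≥0) (f : ℕ → ℝ≥0∞) :
    ∫⁻ n, (n : ℝ≥0∞) * f n ∂poissonMeasure r = r * ∫⁻ n, f (n + 1) ∂poissonMeasure r := by
  simp only [poissonMeasure, lintegral_sum_measure, lintegral_smul_measure, lintegral_dirac,
    smul_eq_mul]
  -- The term n = 0 vanishes; shifting the index by one lets the factor n + 1 cancel against (n +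
  -- 1)!.
  rw [tsum_eq_zero_add' ENNReal.summable, ← ENNReal.tsum_mul_left]
  simp only [Nat.cast_zero, zero_mul, mul_zero, zero_add]
  refine tsum_congr fun n => ?_
  rw [← mul_assoc, ← mul_assoc]
  congr 1
  rw [← ENNReal.ofReal_natCast, ← ENNReal.ofReal_coe_nnreal, ← ENNReal.ofReal_mul (by positivity),
    ← ENNReal.ofReal_mul (by positivity)]
  congr 1
  rw [Nat.factorial_succ]
  push_cast
  field

lemma lintegral_natCast_poissonMeasure (r : ℝ≥0) :
    ∫⁻ n, (n : ℝ≥0∞) ∂poissonMeasure r = r := by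
  simpa using lintegral_natCast_mul_poissonMeasure r 1

lemma lintegral_natCast_mul_self_poissonMeasure (r : ℝ≥0) :
    ∫⁻ n, (n : ℝ≥0∞) * n ∂poissonMeasure r = r * r + r := by
  rw [lintegral_natCast_mul_poissonMeasure]
  simp only [Nat.cast_add, Nat.cast_one]
  rw [lintegral_add_right _ measurable_const, lintegral_natCast_poissonMeasure]
  simp [mul_add]

/-! ### Measurable sets of finite measure -/

/-- The law of the counts is prescribed only on sets of finite intensity. These form a generating
π-system, so identities checked on them extend to equalities of measures. -/
lemma generateFrom_measurableSet_lt_top {E : Type*} [mE : MeasurableSpace E] (μ : Measure E)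
    [SigmaFinite μ] :
    MeasurableSpace.generateFrom {s : Set E | MeasurableSet s ∧ μ s < ∞} = mE := by
  refine le_antisymm (MeasurableSpace.generateFrom_le fun s hs => hs.1) fun s hs => ?_
  rw [← Set.inter_univ s, ← iUnion_spanningSets μ, Set.inter_iUnion]
  refine MeasurableSet.iUnion fun i => MeasurableSpace.measurableSet_generateFrom
    ⟨hs.inter (measurableSet_spanningSets μ i), ?_⟩
  exact (measure_mono Set.inter_subset_right).trans_lt (measure_spanningSets_lt_top μ i)

lemma isPiSystem_measurableSet_lt_top {E : Type*} [MeasurableSpace E] (μ : Measure E) :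
    IsPiSystem {s : Set E | MeasurableSet s ∧ μ s < ∞} :=
  fun _ hs _ ht _ => ⟨hs.1.inter ht.1, (measure_mono Set.inter_subset_left).trans_lt hs.2⟩

/-- A sigma-finite measure is spanned by the measurable sets of finite measure. -/
noncomputable def finiteSpanningSetsInLtTop {E : Type*} [MeasurableSpace E] (μ : Measure E)
    [SigmaFinite μ] : μ.FiniteSpanningSetsIn {s : Set E | MeasurableSet s ∧ μ s < ∞} where
  set := spanningSets μ
  set_mem i := ⟨measurableSet_spanningSets μ i, measure_spanningSets_lt_top μ i⟩
  finite := measure_spanningSets_lt_top μ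
  spanning := iUnion_spanningSets μ

/-! ### Counting variables -/

lemma toENNReal_pointCount {Ω E : Type*} (X : ℕ → Ω → E) (B : Set E) (ω : Ω) :
    ((pointCount X B ω : ℕ∞) : ℝ≥0∞) = ∑' i, B.indicator 1 (X i ω) := by
  rw [pointCount, ← Measure.count_apply (MeasurableSet.of_discrete),
    ← lintegral_indicator_one MeasurableSet.of_discrete, lintegral_count]
  rfl

lemma pointCount_union {Ω E : Type*} (X : ℕ → Ω → E) {A B : Set E} (h : Disjoint A B) (ω : Ω) :
    pointCount X (A ∪ B) ω = pointCount X A ω + pointCount X B ω := by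
  rw [pointCount, pointCount, pointCount, ← Set.encard_union_eq]
  · rfl
  · exact Set.disjoint_left.2 fun i hA hB => Set.disjoint_left.1 h hA hB

/-- The diagonal and the off-diagonal part of the mean of a product of two series. -/
lemma lintegral_tsum_mul_tsum {Ω : Type*} [MeasurableSpace Ω] {P : Measure Ω}
    {a b : ℕ → Ω → ℝ≥0∞} (ha : ∀ i, Measurable (a i)) (hb : ∀ i, Measurable (b i)) :
    ∫⁻ ω, (∑' i, a i ω) * (∑' j, b j ω) ∂P =
      (∑' i, ∑' j, if j = i then 0 else ∫⁻ ω, a i ω * b j ω ∂P) +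
        ∑' i, ∫⁻ ω, a i ω * b i ω ∂P := by
  simp only [← ENNReal.tsum_mul_right]
  rw [lintegral_tsum (f := fun i ω => a i ω * ∑' j, b j ω)
      fun i => ((ha i).mul (Measurable.tsum hb)).aemeasurable,
    ← ENNReal.tsum_add]
  refine tsum_congr fun i => ?_
  simp only [← ENNReal.tsum_mul_left]
  rw [lintegral_tsum (f := fun j ω => a i ω * b j ω) fun j => ((ha i).mul (hb j)).aemeasurable,
    ENNReal.tsum_eq_add_tsum_ite i, add_comm]
  congr!

/-! ### First and second moment measures of a Poisson point process -/

namespace IsPoissonPointProcess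

variable {Ω E : Type*} [MeasurableSpace Ω] [MeasurableSpace E] {μ : Measure E} {X : ℕ → Ω → E}
  {P : Measure Ω}

lemma measurable_toENNReal_pointCount (hX : IsPoissonPointProcess μ X P) {B : Set E}
    (hB : MeasurableSet B) : Measurable fun ω => ((pointCount X B ω : ℕ∞) : ℝ≥0∞) := by
  simp only [toENNReal_pointCount]
  exact Measurable.tsum fun i => (measurable_one.indicator hB).comp (hX.measurable i)

lemma lintegral_comp_pointCount (hX : IsPoissonPointProcess μ X P) {B : Set E}
    (hB : MeasurableSet B) (hμB : μ B ≠ ∞) (f : ℕ∞ → ℝ≥0∞) :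
    ∫⁻ ω, f (pointCount X B ω) ∂P = ∫⁻ n : ℕ, f n ∂poissonMeasure (μ B).toNNReal := by
  have hlaw := hX.count_law B hB hμB
  rw [← lintegral_map' (Measurable.of_discrete (f := f)).aemeasurable hlaw.aemeasurable,
    hlaw.map_eq, lintegral_map Measurable.of_discrete Measurable.of_discrete]

lemma lintegral_pointCount (hX : IsPoissonPointProcess μ X P) {B : Set E}
    (hB : MeasurableSet B) (hμB : μ B ≠ ∞) :
    ∫⁻ ω, ((pointCount X B ω : ℕ∞) : ℝ≥0∞) ∂P = μ B := by
  rw [hX.lintegral_comp_pointCount hB hμB (fun n => (n : ℝ≥0∞))]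
  simp only [ENat.toENNReal_coe]
  rw [lintegral_natCast_poissonMeasure, ENNReal.coe_toNNReal hμB]

lemma lintegral_pointCount_mul_self (hX : IsPoissonPointProcess μ X P) {B : Set E}
    (hB : MeasurableSet B) (hμB : μ B ≠ ∞) :
    ∫⁻ ω, ((pointCount X B ω : ℕ∞) : ℝ≥0∞) * (pointCount X B ω : ℕ∞) ∂P = μ B * μ B + μ B := by
  rw [hX.lintegral_comp_pointCount hB hμB (fun n => (n : ℝ≥0∞) * n)]
  simp only [ENat.toENNReal_coe]
  rw [lintegral_natCast_mul_self_poissonMeasure, ENNReal.coe_toNNReal hμB]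

lemma lintegral_pointCount_mul_of_disjoint (hX : IsPoissonPointProcess μ X P) {A B : Set E}
    (hA : MeasurableSet A) (hμA : μ A ≠ ∞) (hB : MeasurableSet B) (hμB : μ B ≠ ∞)
    (hAB : Disjoint A B) :
    ∫⁻ ω, ((pointCount X A ω : ℕ∞) : ℝ≥0∞) * (pointCount X B ω : ℕ∞) ∂P = μ A * μ B := by
  have hind : IndepFun (pointCount X A) (pointCount X B) P := by
    refine (hX.count_indep 2 ![A, B] ?_ ?_ ?_).indepFun (i := 0) (j := 1) (by simp)
    · simp [Fin.forall_fin_two, hA, hB]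
    · simp [Fin.forall_fin_two, hμA, hμB]
    · intro i j hij
      fin_cases i <;> fin_cases j <;> simp_all [disjoint_comm]
  have := lintegral_mul_eq_lintegral_mul_lintegral_of_indepFun
    (hX.measurable_toENNReal_pointCount hA) (hX.measurable_toENNReal_pointCount hB)
    (hind.comp (φ := fun n : ℕ∞ => (n : ℝ≥0∞)) (ψ := fun n : ℕ∞ => (n : ℝ≥0∞))
      Measurable.of_discrete Measurable.of_discrete)
  rw [← hX.lintegral_pointCount hA hμA, ← hX.lintegral_pointCount hB hμB, ← this]
  rfl

/-- Cut A and B into the disjoint pieces A ∩ B, A \ B and B \ A. Independence factors every mixed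
product of counts; only the square of the count of A ∩ B leaves an extra term, the Poisson variance
μ(A ∩ B). -/
lemma lintegral_pointCount_mul (hX : IsPoissonPointProcess μ X P) {A B : Set E}
    (hA : MeasurableSet A) (hμA : μ A ≠ ∞) (hB : MeasurableSet B) (hμB : μ B ≠ ∞) :
    ∫⁻ ω, ((pointCount X A ω : ℕ∞) : ℝ≥0∞) * (pointCount X B ω : ℕ∞) ∂P =
      μ A * μ B + μ (A ∩ B) := by
  have hC : MeasurableSet (A ∩ B) := hA.inter hB
  have hμC : μ (A ∩ B) ≠ ∞ := measure_ne_top_of_subset Set.inter_subset_left hμA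
  have hA' : MeasurableSet (A \ B) := hA.diff hB
  have hμA' : μ (A \ B) ≠ ∞ := measure_ne_top_of_subset Set.sdiff_subset hμA
  have hB' : MeasurableSet (B \ A) := hB.diff hA
  have hμB' : μ (B \ A) ≠ ∞ := measure_ne_top_of_subset Set.sdiff_subset hμB
  have d1 : Disjoint (A ∩ B) (A \ B) := Set.disjoint_sdiff_inter.symm
  have d2 : Disjoint (A ∩ B) (B \ A) := by
    rw [Set.inter_comm]; exact Set.disjoint_sdiff_inter.symm
  have d3 : Disjoint (A \ B) (B \ A) := disjoint_sdiff_sdiff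
  have eA : A = A ∩ B ∪ A \ B := (Set.inter_union_sdiff A B).symm
  have eB : B = A ∩ B ∪ B \ A := by rw [Set.inter_comm]; exact (Set.inter_union_sdiff B A).symm
  have hNA : ∀ ω, pointCount X A ω = pointCount X (A ∩ B) ω + pointCount X (A \ B) ω := fun ω => by
    conv_lhs => rw [eA]
    exact pointCount_union X d1 ω
  have hNB : ∀ ω, pointCount X B ω = pointCount X (A ∩ B) ω + pointCount X (B \ A) ω := fun ω => by
    conv_lhs => rw [eB]
    exact pointCount_union X d2 ω
  have mA : μ A = μ (A ∩ B) + μ (A \ B) := by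
    conv_lhs => rw [eA]
    exact measure_union d1 hA'
  have mB : μ B = μ (A ∩ B) + μ (B \ A) := by
    conv_lhs => rw [eB]
    exact measure_union d2 hB'
  have mC := hX.measurable_toENNReal_pointCount hC
  have mA' := hX.measurable_toENNReal_pointCount hA'
  have mB' := hX.measurable_toENNReal_pointCount hB'
  simp only [hNA, hNB, ENat.toENNReal_add, add_mul, mul_add]
  rw [lintegral_add_left (by fun_prop), lintegral_add_left (by fun_prop),
    lintegral_add_left (by fun_prop), hX.lintegral_pointCount_mul_self hC hμC,
    hX.lintegral_pointCount_mul_of_disjoint hC hμC hB' hμB' d2,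
    hX.lintegral_pointCount_mul_of_disjoint hA' hμA' hC hμC d1.symm,
    hX.lintegral_pointCount_mul_of_disjoint hA' hμA' hB' hμB' d3, mA, mB]
  ring

/-- The intensity measure of a Poisson point process. -/
lemma sum_map [SigmaFinite μ] (hX : IsPoissonPointProcess μ X P) :
    Measure.sum (fun i => P.map (X i)) = μ := by
  have key : ∀ B : Set E, MeasurableSet B → μ B < ∞ →
      Measure.sum (fun i => P.map (X i)) B = μ B := fun B hB hμB => by
    rw [Measure.sum_apply _ hB, ← hX.lintegral_pointCount hB hμB.ne]
    simp only [toENNReal_pointCount]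
    rw [lintegral_tsum (f := fun i ω => B.indicator 1 (X i ω))
      fun i => ((measurable_one.indicator hB).comp (hX.measurable i)).aemeasurable]
    refine tsum_congr fun i => ?_
    rw [← lintegral_indicator_one hB, lintegral_map (measurable_one.indicator hB) (hX.measurable i)]
  refine (Measure.ext_of_generateFrom_of_iUnion _ (spanningSets μ)
    (generateFrom_measurableSet_lt_top μ).symm (isPiSystem_measurableSet_lt_top μ)
    (iUnion_spanningSets μ) (finiteSpanningSetsInLtTop μ).set_mem
    (fun i => (measure_spanningSets_lt_top μ i).ne) fun s hs => (key s hs.1 hs.2).symm).symm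

/-- **Campbell's theorem**. -/
theorem tsum_lintegral_comp [SigmaFinite μ] (hX : IsPoissonPointProcess μ X P) {f : E → ℝ≥0∞}
    (hf : Measurable f) : ∑' i, ∫⁻ ω, f (X i ω) ∂P = ∫⁻ x, f x ∂μ := by
  rw [← congrArg (fun m => ∫⁻ x, f x ∂m) hX.sum_map, lintegral_sum_measure]
  exact tsum_congr fun i => (lintegral_map hf (hX.measurable i)).symm

/-- The second factorial moment measure of a Poisson point process. -/
lemma prod_eq_sum_map [SigmaFinite μ] (hX : IsPoissonPointProcess μ X P) :
    μ.prod μ = Measure.sum fun i => Measure.sum fun j =>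
      if j = i then 0 else P.map (fun ω => (X i ω, X j ω)) := by
  refine Measure.prod_eq_generateFrom (generateFrom_measurableSet_lt_top μ)
    (generateFrom_measurableSet_lt_top μ) (isPiSystem_measurableSet_lt_top μ)
    (isPiSystem_measurableSet_lt_top μ) (finiteSpanningSetsInLtTop μ) (finiteSpanningSetsInLtTop μ)
    ?_
  rintro A ⟨hA, hμA⟩ B ⟨hB, hμB⟩
  have hC := hA.inter hB
  have hμC : μ (A ∩ B) ≠ ∞ := measure_ne_top_of_subset Set.inter_subset_left hμA.ne
  have hm : ∀ {S : Set E}, MeasurableSet S → ∀ i,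
      Measurable fun ω => S.indicator (1 : E → ℝ≥0∞) (X i ω) :=
    fun hS i => (measurable_one.indicator hS).comp (hX.measurable i)
  -- Adding the finite quantity μ(A ∩ B), which is the diagonal sum, completes the off-diagonal sum
  -- to the full moment E[N(A)N(B)].
  refine (ENNReal.add_left_inj hμC).1 ?_
  rw [← hX.lintegral_pointCount_mul hA hμA.ne hB hμB.ne,
    ← congrArg (fun m : Measure E => m (A ∩ B)) hX.sum_map, Measure.sum_apply _ hC,
    Measure.sum_apply _ (hA.prod hB)]
  simp only [toENNReal_pointCount]
  rw [lintegral_tsum_mul_tsum (hm hA) (hm hB)]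
  congr 1
  · refine tsum_congr fun i => ?_
    rw [Measure.sum_apply _ (hA.prod hB)]
    refine tsum_congr fun j => ?_
    split_ifs with hij
    · simp
    · rw [← lintegral_indicator_one (hA.prod hB), lintegral_map
        (measurable_one.indicator (hA.prod hB)) ((hX.measurable i).prodMk (hX.measurable j))]
      refine lintegral_congr fun ω => ?_
      by_cases h1 : X i ω ∈ A <;> by_cases h2 : X j ω ∈ B <;> simp [h1, h2]
  · refine tsum_congr fun i => ?_
    rw [← lintegral_indicator_one hC, lintegral_map (measurable_one.indicator hC) (hX.measurable i)]
    refine lintegral_congr fun ω => ?_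
    by_cases h1 : X i ω ∈ A <;> by_cases h2 : X i ω ∈ B <;> simp [h1, h2]

/-- **Campbell's theorem** for pairs of distinct points. -/
theorem tsum_lintegral_mul_comp [SigmaFinite μ] (hX : IsPoissonPointProcess μ X P)
    {f g : E → ℝ≥0∞} (hf : Measurable f) (hg : Measurable g) :
    ∑' i, ∑' j, (if j = i then 0 else ∫⁻ ω, f (X i ω) * g (X j ω) ∂P) =
      (∫⁻ x, f x ∂μ) * ∫⁻ x, g x ∂μ := by
  rw [← lintegral_prod_mul hf.aemeasurable hg.aemeasurable, hX.prod_eq_sum_map,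
    lintegral_sum_measure]
  refine tsum_congr fun i => ?_
  rw [lintegral_sum_measure]
  refine tsum_congr fun j => ?_
  split_ifs with hij
  · simp
  · exact (lintegral_map (f := fun q : E × E => f q.1 * g q.2) (by fun_prop)
      ((hX.measurable i).prodMk (hX.measurable j))).symm

/-- Second moments of sums over a Poisson point process with independent marks. -/
theorem lintegral_tsum_mark_mul_tsum_mark [SigmaFinite μ] (hX : IsPoissonPointProcess μ X P)
    {f g : E → ℝ≥0∞} (hf : Measurable f) (hg : Measurable g) {V W : ℕ → Ω → ℝ≥0∞}
    (hV : ∀ i, Measurable (V i)) (hW : ∀ i, Measurable (W i))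
    (hind : ∀ i j, IndepFun (fun ω => (X i ω, X j ω)) (fun ω => V i ω * W j ω) P)
    {a c : ℝ≥0∞} (hoff : ∀ i j, j ≠ i → ∫⁻ ω, V i ω * W j ω ∂P = a)
    (hdiag : ∀ i, ∫⁻ ω, V i ω * W i ω ∂P = c) :
    ∫⁻ ω, (∑' i, V i ω * f (X i ω)) * (∑' j, W j ω * g (X j ω)) ∂P =
      a * ((∫⁻ x, f x ∂μ) * ∫⁻ x, g x ∂μ) + c * ∫⁻ x, f x * g x ∂μ := by
  -- Positions separate from marks even when i = j; the two marks need not be independent of each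
  -- other.
  have hsplit : ∀ i j, ∫⁻ ω, (V i ω * f (X i ω)) * (W j ω * g (X j ω)) ∂P =
      (∫⁻ ω, V i ω * W j ω ∂P) * ∫⁻ ω, f (X i ω) * g (X j ω) ∂P := fun i j => by
    have hi := hX.measurable i
    have hj := hX.measurable j
    have h := (hind i j).symm.comp (φ := id) (ψ := fun q : E × E => f q.1 * g q.2)
      measurable_id (by fun_prop)
    have hp := lintegral_mul_eq_lintegral_mul_lintegral_of_indepFun
      ((hV i).mul (hW j)) (by fun_prop) h
    exact (lintegral_congr fun ω => by simp; ring).trans hp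
  rw [lintegral_tsum_mul_tsum (a := fun i ω => V i ω * f (X i ω))
    (b := fun i ω => W i ω * g (X i ω)) (fun i => (hV i).mul (hf.comp (hX.measurable i)))
    (fun i => (hW i).mul (hg.comp (hX.measurable i)))]
  simp only [hsplit, hdiag, ENNReal.tsum_mul_left]
  rw [hX.tsum_lintegral_comp (f := fun x => f x * g x) (hf.mul hg), ← hX.tsum_lintegral_mul_comp hf hg,
    ← ENNReal.tsum_mul_left]
  congr 1
  refine tsum_congr fun i => ?_
  rw [← ENNReal.tsum_mul_left]
  refine tsum_congr fun j => ?_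
  split_ifs with hij
  · simp
  · rw [hoff i j hij]

/-- First moments of sums over a Poisson point process with independent marks. -/
theorem lintegral_tsum_mark [SigmaFinite μ] (hX : IsPoissonPointProcess μ X P)
    {f : E → ℝ≥0∞} (hf : Measurable f) {V : ℕ → Ω → ℝ≥0∞} (hV : ∀ i, Measurable (V i))
    (hind : ∀ i, IndepFun (X i) (V i) P) {a : ℝ≥0∞} (ha : ∀ i, ∫⁻ ω, V i ω ∂P = a) :
    ∫⁻ ω, ∑' i, V i ω * f (X i ω) ∂P = a * ∫⁻ x, f x ∂μ := by
  rw [lintegral_tsum (f := fun i ω => V i ω * f (X i ω)) fun i => ((hV i).mul (hf.comp (hX.measurable i))).aemeasurable,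
    ← hX.tsum_lintegral_comp hf, ← ENNReal.tsum_mul_left]
  refine tsum_congr fun i => ?_
  rw [← ha i]
  exact lintegral_mul_eq_lintegral_mul_lintegral_of_indepFun (hV i) (hf.comp (hX.measurable i))
    ((hind i).symm.comp measurable_id hf)

end IsPoissonPointProcess

/-! ### Integrability and symmetry of the path loss -/

namespace IsPathLoss

variable {g : Plane → ℝ}

lemma le_zero (hg : IsPathLoss g) (x : Plane) : g x ≤ g 0 := hg.antitone _ _ (by simp)

lemma eq_single_norm (hg : IsPathLoss g) (x : Plane) :
    g x = g (EuclideanSpace.single 0 ‖x‖) := hg.radial _ _ (by simp)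

lemma measurable (hg : IsPathLoss g) : Measurable g := by
  -- At negative r the norm of the point is |r|, so truncation at 0 is needed for monotonicity on
  -- all of ℝ.
  have hanti : Antitone fun r : ℝ => g (EuclideanSpace.single 0 (max r 0)) := fun r s hrs =>
    hg.antitone _ _ (by
      simp only [PiLp.norm_single, Real.norm_eq_abs]
      rw [abs_of_nonneg (le_max_right _ _), abs_of_nonneg (le_max_right _ _)]
      exact max_le_max_right 0 hrs)
  have : g = (fun r : ℝ => g (EuclideanSpace.single 0 (max r 0))) ∘ fun x => ‖x‖ := by
    ext x
    simp only [Function.comp_apply, max_eq_left (norm_nonneg x)]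
    exact hg.eq_single_norm x
  rw [this]
  exact hanti.measurable.comp measurable_norm

/-- Polar coordinates: in dimension two the radial weight is r up to a constant. -/
protected lemma integrable_self (hg : IsPathLoss g) : Integrable g := by
  have h := (integrable_fun_norm_addHaar (volume : Measure Plane)
    (f := fun r : ℝ => g (EuclideanSpace.single 0 r))).2 (by simpa using hg.integrable)
  exact h.congr (Filter.Eventually.of_forall fun x => (hg.eq_single_norm x).symm)

/-- One factor is integrable and the other is bounded by the finite value g(0). -/
lemma integrable_mul_comp_sub (hg : IsPathLoss g) (u v : Plane) :
    Integrable fun x => g (x - u) * g (x - v) := by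
  refine (hg.integrable_self.comp_sub_right u).mul_bdd (c := g 0) ?_ ?_
  · exact (hg.measurable.comp (measurable_sub_const v)).aestronglyMeasurable
  · refine Filter.Eventually.of_forall fun x => ?_
    rw [Real.norm_of_nonneg (hg.nonneg _)]
    exact hg.le_zero _

lemma integrable_sq (hg : IsPathLoss g) : Integrable fun x => g x ^ 2 := by
  simpa [sq] using hg.integrable_mul_comp_sub 0 0

/-- By monotonicity g is positive on the ball of radius ‖x₀‖ about the origin, which has positive
area because x₀ ≠ 0. -/
lemma integral_sq_pos (hg : IsPathLoss g) (hg0 : ∃ x, x ≠ 0 ∧ 0 < g x) :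
    0 < ∫ x, g x ^ 2 := by
  obtain ⟨x₀, hx₀, hpos⟩ := hg0
  rw [integral_pos_iff_support_of_nonneg (fun x => sq_nonneg (g x)) hg.integrable_sq]
  refine (Metric.measure_ball_pos volume (0 : Plane) (norm_pos_iff.2 hx₀)).trans_le
    (measure_mono fun x hx => ?_)
  have : 0 < g x := hpos.trans_le (hg.antitone _ _ (mem_ball_zero_iff.1 hx).le)
  exact (pow_pos this 2).ne'

/-- Lebesgue measure is invariant under translations and linear isometries, and g under the latter,
so the integral depends only on the distance of u and v. -/
lemma integral_mul_comp_sub (hg : IsPathLoss g) (u v : Plane) :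
    ∫ x, g (x - u) * g (x - v) = ∫ x, g x * g (x - EuclideanSpace.single 0 ‖u - v‖) := by
  set w : Plane := EuclideanSpace.single 0 ‖u - v‖ with hw
  have hnorm : ‖w‖ = ‖v - u‖ := by simp [hw, norm_sub_rev u v]
  -- Since w and v - u have equal norms, reflection in the line orthogonal to their difference maps
  -- one to the other.
  let R := (ℝ ∙ (w - (v - u)))ᗮ.reflection
  have hR : R w = v - u := Submodule.reflection_sub hnorm
  calc ∫ x, g (x - u) * g (x - v) = ∫ x, g x * g (x - (v - u)) := by
        rw [← integral_sub_right_eq_self (fun x => g x * g (x - (v - u))) u]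
        exact integral_congr_ae (Filter.Eventually.of_forall fun x => by
          simp only [sub_sub]; congr 3; abel)
    _ = ∫ x, g (R x) * g (R x - (v - u)) :=
        (R.measurePreserving.integral_comp' (f := R.toMeasurableEquiv)
          (fun x => g x * g (x - (v - u)))).symm
    _ = ∫ x, g x * g (x - w) := by
        refine integral_congr_ae (Filter.Eventually.of_forall fun x => ?_)
        simp only
        rw [← hR, ← map_sub, hg.radial (R x) x (R.norm_map x),
          hg.radial (R (x - w)) (x - w) (R.norm_map _)]

lemma lintegral_comp_sub (hg : IsPathLoss g) (u : Plane) :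
    ∫⁻ x, ENNReal.ofReal (g (x - u)) = ENNReal.ofReal (∫ x, g x) := by
  rw [← integral_sub_right_eq_self g u, ofReal_integral_eq_lintegral_ofReal
    (hg.integrable_self.comp_sub_right u) (Filter.Eventually.of_forall fun x => hg.nonneg _)]

lemma lintegral_mul_comp_sub (hg : IsPathLoss g) (u v : Plane) :
    ∫⁻ x, ENNReal.ofReal (g (x - u)) * ENNReal.ofReal (g (x - v)) =
      ENNReal.ofReal (∫ x, g (x - u) * g (x - v)) := by
  rw [ofReal_integral_eq_lintegral_ofReal (hg.integrable_mul_comp_sub u v)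
    (Filter.Eventually.of_forall fun x => mul_nonneg (hg.nonneg _) (hg.nonneg _))]
  exact lintegral_congr fun x => (ENNReal.ofReal_mul (hg.nonneg _)).symm

end IsPathLoss

/-! ### Interference with values in [0,∞] -/

/-- The indicator of the transmission of node `i` in slot `n`. -/
noncomputable def transmitWeight {Ω : Type*} (T : ℕ → ℕ → Ω → Bool) (n i : ℕ) (ω : Ω) : ℝ≥0∞ :=
  if T i n ω = true then 1 else 0

/-- The weight of node `i` in the interference at `z` in slot `n`. -/
noncomputable def markWeight {Ω : Type*} (T : ℕ → ℕ → Ω → Bool) (h : ℕ → Plane → ℕ → Ω → ℝ)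
    (n : ℕ) (z : Plane) (i : ℕ) (ω : Ω) : ℝ≥0∞ :=
  transmitWeight T n i ω * ENNReal.ofReal (h i z n ω)

/-- The interference with values in `[0, ∞]`. -/
noncomputable def extInterference {Ω : Type*} (g : Plane → ℝ) (X : ℕ → Ω → Plane)
    (T : ℕ → ℕ → Ω → Bool) (h : ℕ → Plane → ℕ → Ω → ℝ) (n : ℕ) (z : Plane) (ω : Ω) : ℝ≥0∞ :=
  ∑' i, markWeight T h n z i ω * ENNReal.ofReal (g (X i ω - z))

lemma toReal_markWeight_mul {Ω : Type*} {X : ℕ → Ω → Plane} {T : ℕ → ℕ → Ω → Bool}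
    {h : ℕ → Plane → ℕ → Ω → ℝ} {g : Plane → ℝ} (hg : IsPathLoss g) {n i : ℕ} {z : Plane} {ω : Ω}
    (hpos : 0 ≤ h i z n ω) :
    (markWeight T h n z i ω * ENNReal.ofReal (g (X i ω - z))).toReal =
      interferenceTerm g X T h n z i ω := by
  unfold markWeight transmitWeight interferenceTerm
  split_ifs <;> simp [hpos, hg.nonneg]

namespace IsAlohaNetwork

variable {Ω : Type*} [MeasurableSpace Ω] {P : Measure Ω} {lam : ℝ≥0} {p : ℝ} {ν : Measure ℝ}
  {X : ℕ → Ω → Plane} {T : ℕ → ℕ → Ω → Bool} {h : ℕ → Plane → ℕ → Ω → ℝ} {g : Plane → ℝ}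

/-! ### Moments of the marks -/

lemma measurable_transmitWeight (hnet : IsAlohaNetwork lam p ν X T h P) (n i : ℕ) :
    Measurable (transmitWeight T n i) :=
  (Measurable.of_discrete (f := fun b : Bool => if b = true then (1 : ℝ≥0∞) else 0)).comp
    (hnet.transmit_measurable i n)

lemma measurable_markWeight (hnet : IsAlohaNetwork lam p ν X T h P) (n : ℕ) (z : Plane) (i : ℕ) :
    Measurable (markWeight T h n z i) :=
  (hnet.measurable_transmitWeight n i).mul (hnet.fading_measurable i z n).ennreal_ofReal

lemma lintegral_transmitWeight [IsFiniteMeasure P] (hnet : IsAlohaNetwork lam p ν X T h P)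
    (n i : ℕ) : ∫⁻ ω, transmitWeight T n i ω ∂P = ENNReal.ofReal p := by
  have hm : MeasurableSet {ω | T i n ω = true} :=
    hnet.transmit_measurable i n (measurableSet_singleton true)
  rw [← hnet.transmit_prob i n, ofReal_measureReal, ← lintegral_indicator_one hm]
  exact lintegral_congr fun ω => by simp [transmitWeight, Set.indicator]

lemma lintegral_transmitWeight_mul [IsFiniteMeasure P] (hnet : IsAlohaNetwork lam p ν X T h P)
    {n m i j : ℕ} (hne : (i, n) ≠ (j, m)) :
    ∫⁻ ω, transmitWeight T n i ω * transmitWeight T m j ω ∂P =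
      ENNReal.ofReal p * ENNReal.ofReal p := by
  have hφ : Measurable fun b : Bool => if b = true then (1 : ℝ≥0∞) else 0 := .of_discrete
  have := lintegral_mul_eq_lintegral_mul_lintegral_of_indepFun
    (hnet.measurable_transmitWeight n i) (hnet.measurable_transmitWeight m j)
    ((hnet.transmit_indep.indepFun hne).comp hφ hφ)
  rw [hnet.lintegral_transmitWeight, hnet.lintegral_transmitWeight] at this
  exact this

lemma lintegral_fading_comp (hnet : IsAlohaNetwork lam p ν X T h P) (i : ℕ) (z : Plane) (n : ℕ)
    {f : ℝ → ℝ≥0∞} (hf : Measurable f) : ∫⁻ ω, f (h i z n ω) ∂P = ∫⁻ t, f t ∂ν := by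
  rw [← (hnet.fading_law i z n).map_eq, lintegral_map hf (hnet.fading_measurable i z n)]

lemma lintegral_ofReal_fading (hnet : IsAlohaNetwork lam p ν X T h P) (i : ℕ) (z : Plane)
    (n : ℕ) : ∫⁻ ω, ENNReal.ofReal (h i z n ω) ∂P = 1 := by
  -- The integral of a non-integrable function is 0 by convention, so mean one forces integrability.
  have hint : Integrable (fun t : ℝ => t) ν :=
    Integrable.of_integral_ne_zero (by rw [hnet.fading_mean]; exact one_ne_zero)
  rw [hnet.lintegral_fading_comp i z n ENNReal.measurable_ofReal,
    ← ofReal_integral_eq_lintegral_ofReal hint hnet.fading_nonneg, hnet.fading_mean,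
    ENNReal.ofReal_one]

lemma lintegral_ofReal_fading_mul (hnet : IsAlohaNetwork lam p ν X T h P) {i j n m : ℕ}
    {z w : Plane} (hne : (i, z, n) ≠ (j, w, m)) :
    ∫⁻ ω, ENNReal.ofReal (h i z n ω) * ENNReal.ofReal (h j w m ω) ∂P = 1 := by
  have := lintegral_mul_eq_lintegral_mul_lintegral_of_indepFun
    (hnet.fading_measurable i z n).ennreal_ofReal (hnet.fading_measurable j w m).ennreal_ofReal
    ((hnet.fading_indep.indepFun hne).comp ENNReal.measurable_ofReal ENNReal.measurable_ofReal)
  rw [hnet.lintegral_ofReal_fading, hnet.lintegral_ofReal_fading, mul_one] at this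
  exact this

lemma lintegral_ofReal_fading_mul_self (hnet : IsAlohaNetwork lam p ν X T h P) (i : ℕ)
    (z : Plane) (n : ℕ) :
    ∫⁻ ω, ENNReal.ofReal (h i z n ω) * ENNReal.ofReal (h i z n ω) ∂P =
      ENNReal.ofReal (∫ t, t ^ 2 ∂ν) := by
  rw [hnet.lintegral_fading_comp i z n (f := fun t => ENNReal.ofReal t * ENNReal.ofReal t)
      (by fun_prop), ofReal_integral_eq_lintegral_ofReal hnet.fading_sq
      (Filter.Eventually.of_forall fun t => sq_nonneg t)]
  refine lintegral_congr_ae ?_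
  filter_upwards [hnet.fading_nonneg] with t ht
  rw [sq, ENNReal.ofReal_mul ht]

lemma lintegral_markWeight [IsFiniteMeasure P] (hnet : IsAlohaNetwork lam p ν X T h P)
    (n : ℕ) (z : Plane) (i : ℕ) : ∫⁻ ω, markWeight T h n z i ω ∂P = ENNReal.ofReal p := by
  have hφ : Measurable fun b : ℕ → ℕ → Bool => if b i n = true then (1 : ℝ≥0∞) else 0 :=
    (Measurable.of_discrete (f := fun b : Bool => if b = true then (1 : ℝ≥0∞) else 0)).comp
      (f := fun b : ℕ → ℕ → Bool => b i n) (by fun_prop)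
  have hψ : Measurable fun t : ℕ → Plane → ℕ → ℝ => ENNReal.ofReal (t i z n) := by fun_prop
  have := lintegral_mul_eq_lintegral_mul_lintegral_of_indepFun
    (hnet.measurable_transmitWeight n i) (hnet.fading_measurable i z n).ennreal_ofReal
    (hnet.indep_transmit_fading.comp hφ hψ)
  rw [hnet.lintegral_transmitWeight, hnet.lintegral_ofReal_fading, mul_one] at this
  exact this

lemma lintegral_markWeight_mul (hnet : IsAlohaNetwork lam p ν X T h P)
    (n m : ℕ) (z w : Plane) (i j : ℕ) :
    ∫⁻ ω, markWeight T h n z i ω * markWeight T h m w j ω ∂P =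
      (∫⁻ ω, transmitWeight T n i ω * transmitWeight T m j ω ∂P) *
        ∫⁻ ω, ENNReal.ofReal (h i z n ω) * ENNReal.ofReal (h j w m ω) ∂P := by
  have hb : Measurable fun b : Bool => if b = true then (1 : ℝ≥0∞) else 0 := .of_discrete
  have hφ : Measurable fun b : ℕ → ℕ → Bool =>
      (if b i n = true then (1 : ℝ≥0∞) else 0) * (if b j m = true then (1 : ℝ≥0∞) else 0) :=
    (hb.comp (f := fun b : ℕ → ℕ → Bool => b i n) (by fun_prop)).mul
      (hb.comp (f := fun b : ℕ → ℕ → Bool => b j m) (by fun_prop))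
  have hψ : Measurable fun t : ℕ → Plane → ℕ → ℝ =>
      ENNReal.ofReal (t i z n) * ENNReal.ofReal (t j w m) := by fun_prop
  have := lintegral_mul_eq_lintegral_mul_lintegral_of_indepFun
    ((hnet.measurable_transmitWeight n i).mul (hnet.measurable_transmitWeight m j))
    ((hnet.fading_measurable i z n).ennreal_ofReal.mul (hnet.fading_measurable j w m).ennreal_ofReal)
    (hnet.indep_transmit_fading.comp hφ hψ)
  exact (lintegral_congr fun ω => mul_mul_mul_comm _ _ _ _).trans this

/-- Differing in node or slot makes both decisions and fadings independent, whatever the locations.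
This serves the off-diagonal terms always, and the diagonal ones for different slots. -/
lemma lintegral_markWeight_mul_of_ne [IsFiniteMeasure P] (hnet : IsAlohaNetwork lam p ν X T h P)
    {n m i j : ℕ} (z w : Plane) (hne : (i, n) ≠ (j, m)) :
    ∫⁻ ω, markWeight T h n z i ω * markWeight T h m w j ω ∂P =
      ENNReal.ofReal p * ENNReal.ofReal p := by
  rw [hnet.lintegral_markWeight_mul, hnet.lintegral_transmitWeight_mul hne,
    hnet.lintegral_ofReal_fading_mul, mul_one]
  exact fun h => hne (by simp_all)

/-- The transmission indicator is idempotent, which gives p instead of p². -/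
lemma lintegral_markWeight_mul_self [IsFiniteMeasure P] (hnet : IsAlohaNetwork lam p ν X T h P)
    (n i : ℕ) (z : Plane) :
    ∫⁻ ω, markWeight T h n z i ω * markWeight T h n z i ω ∂P =
      ENNReal.ofReal p * ENNReal.ofReal (∫ t, t ^ 2 ∂ν) := by
  rw [hnet.lintegral_markWeight_mul, hnet.lintegral_ofReal_fading_mul_self,
    ← hnet.lintegral_transmitWeight n i]
  congr 1
  exact lintegral_congr fun ω => by simp [transmitWeight]

lemma indepFun_position_markWeight (hnet : IsAlohaNetwork lam p ν X T h P) (n : ℕ) (z : Plane)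
    (i : ℕ) : IndepFun (X i) (markWeight T h n z i) P := by
  have hb : Measurable fun b : Bool => if b = true then (1 : ℝ≥0∞) else 0 := .of_discrete
  have hψ : Measurable fun q : (ℕ → ℕ → Bool) × (ℕ → Plane → ℕ → ℝ) =>
      (if q.1 i n = true then (1 : ℝ≥0∞) else 0) * ENNReal.ofReal (q.2 i z n) :=
    (hb.comp (f := fun q : (ℕ → ℕ → Bool) × (ℕ → Plane → ℕ → ℝ) => q.1 i n) (by fun_prop)).mul
      (by fun_prop)
  exact hnet.indep_position_marks.comp (measurable_pi_apply i) hψ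

lemma indepFun_position_markWeight_mul (hnet : IsAlohaNetwork lam p ν X T h P) (n m : ℕ)
    (z w : Plane) (i j : ℕ) :
    IndepFun (fun ω => (X i ω, X j ω))
      (fun ω => markWeight T h n z i ω * markWeight T h m w j ω) P := by
  have hb : Measurable fun b : Bool => if b = true then (1 : ℝ≥0∞) else 0 := .of_discrete
  have hψ : ∀ (n : ℕ) (z : Plane) (i : ℕ),
      Measurable fun q : (ℕ → ℕ → Bool) × (ℕ → Plane → ℕ → ℝ) =>
        (if q.1 i n = true then (1 : ℝ≥0∞) else 0) * ENNReal.ofReal (q.2 i z n) := fun n z i =>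
    (hb.comp (f := fun q : (ℕ → ℕ → Bool) × (ℕ → Plane → ℕ → ℝ) => q.1 i n) (by fun_prop)).mul
      (by fun_prop)
  exact hnet.indep_position_marks.comp
    (φ := fun x : ℕ → Plane => (x i, x j)) (by fun_prop) ((hψ n z i).mul (hψ m w j))

/-! ### Moments of the interference -/

lemma measurable_extInterference (hnet : IsAlohaNetwork lam p ν X T h P) (hg : IsPathLoss g)
    (n : ℕ) (z : Plane) : Measurable (extInterference g X T h n z) :=
  Measurable.tsum fun i => (hnet.measurable_markWeight n z i).mul
    (hg.measurable.comp ((hnet.ppp.measurable i).sub_const z)).ennreal_ofReal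

lemma lintegral_extInterference [IsFiniteMeasure P] (hnet : IsAlohaNetwork lam p ν X T h P)
    (hg : IsPathLoss g) (n : ℕ) (z : Plane) :
    ∫⁻ ω, extInterference g X T h n z ω ∂P =
      ENNReal.ofReal p * (lam * ENNReal.ofReal (∫ x, g x)) := by
  rw [← hg.lintegral_comp_sub z]
  have := hnet.ppp.lintegral_tsum_mark (f := fun x => ENNReal.ofReal (g (x - z)))
    (hg.measurable.comp (measurable_sub_const z)).ennreal_ofReal
    (hnet.measurable_markWeight n z) (hnet.indepFun_position_markWeight n z)
    (hnet.lintegral_markWeight n z)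
  rwa [lintegral_smul_measure] at this

/-- The mark moment c of a single node is left free: its value is all that separates the variance
from the covariance across slots. -/
lemma lintegral_extInterference_mul [IsFiniteMeasure P] (hnet : IsAlohaNetwork lam p ν X T h P)
    (hg : IsPathLoss g) (n m : ℕ) (u v : Plane) {c : ℝ≥0∞}
    (hc : ∀ i, ∫⁻ ω, markWeight T h n u i ω * markWeight T h m v i ω ∂P = c) :
    ∫⁻ ω, extInterference g X T h n u ω * extInterference g X T h m v ω ∂P =
      ENNReal.ofReal p * ENNReal.ofReal p *
          (lam * ENNReal.ofReal (∫ x, g x) * (lam * ENNReal.ofReal (∫ x, g x))) +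
        c * (lam * ENNReal.ofReal (∫ x, g (x - u) * g (x - v))) := by
  have := hnet.ppp.lintegral_tsum_mark_mul_tsum_mark
    (f := fun x => ENNReal.ofReal (g (x - u))) (g := fun x => ENNReal.ofReal (g (x - v)))
    (hg.measurable.comp (measurable_sub_const u)).ennreal_ofReal
    (hg.measurable.comp (measurable_sub_const v)).ennreal_ofReal
    (hnet.measurable_markWeight n u) (hnet.measurable_markWeight m v)
    (hnet.indepFun_position_markWeight_mul n m u v)
    (fun i j hij => hnet.lintegral_markWeight_mul_of_ne u v (by simp [hij.symm])) hc
  simp only [lintegral_smul_measure] at this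
  rw [← hg.lintegral_mul_comp_sub u v]
  conv_rhs => rw [← hg.lintegral_comp_sub u]
  -- The two equal factors ∫ g are shifted differently, by u and by v, to match the moment formula.
  conv_rhs => enter [1, 2, 2]; rw [hg.lintegral_comp_sub u, ← hg.lintegral_comp_sub v]
  exact this

lemma ae_fading_nonneg (hnet : IsAlohaNetwork lam p ν X T h P) (n : ℕ) (z : Plane) :
    ∀ᵐ ω ∂P, ∀ i, 0 ≤ h i z n ω := by
  refine ae_all_iff.2 fun i => ?_
  have := hnet.fading_nonneg
  rw [← (hnet.fading_law i z n).map_eq] at this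
  exact ae_of_ae_map (hnet.fading_law i z n).aemeasurable this

/-- A finite mean makes the [0,∞]-valued sum finite almost surely, and nonnegative fading identifies
its terms with the real ones. -/
lemma ae_summable_and_eq [IsFiniteMeasure P] (hnet : IsAlohaNetwork lam p ν X T h P)
    (hg : IsPathLoss g) (n : ℕ) (z : Plane) :
    ∀ᵐ ω ∂P, (Summable fun i => interferenceTerm g X T h n z i ω) ∧
      interference g X T h n z ω = (extInterference g X T h n z ω).toReal := by
  have hfin : ∀ᵐ ω ∂P, extInterference g X T h n z ω < ∞ := by
    refine ae_lt_top (hnet.measurable_extInterference hg n z) ?_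
    rw [hnet.lintegral_extInterference hg]
    finiteness
  filter_upwards [hnet.ae_fading_nonneg n z, hfin] with ω hpos hω
  have hterm : ∀ i, _ := fun i => toReal_markWeight_mul (T := T) (X := X) hg (hpos i)
  constructor
  · have := ENNReal.summable_toReal hω.ne
    simpa only [hterm] using this
  · rw [extInterference, ENNReal.tsum_toReal_eq (fun i => ENNReal.ne_top_of_tsum_ne_top hω.ne i)]
    simp only [hterm, interference]

lemma aestronglyMeasurable_interference [IsFiniteMeasure P]
    (hnet : IsAlohaNetwork lam p ν X T h P) (hg : IsPathLoss g) (n : ℕ) (z : Plane) :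
    AEStronglyMeasurable (interference g X T h n z) P :=
  (hnet.measurable_extInterference hg n z).ennreal_toReal.aestronglyMeasurable.congr
    ((hnet.ae_summable_and_eq hg n z).mono fun _ hω => hω.2.symm)

lemma integral_interference [IsFiniteMeasure P] (hnet : IsAlohaNetwork lam p ν X T h P)
    (hp : 0 ≤ p) (hg : IsPathLoss g) (n : ℕ) (z : Plane) :
    ∫ ω, interference g X T h n z ω ∂P = p * (lam * ∫ x, g x) := by
  have hm := hnet.measurable_extInterference hg n z
  have hfin : ∫⁻ ω, extInterference g X T h n z ω ∂P ≠ ∞ := by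
    rw [hnet.lintegral_extInterference hg]
    finiteness
  rw [integral_congr_ae ((hnet.ae_summable_and_eq hg n z).mono fun _ hω => hω.2),
    integral_toReal hm.aemeasurable (ae_lt_top hm hfin), hnet.lintegral_extInterference hg]
  simp [hp, integral_nonneg (μ := volume) (f := g) hg.nonneg]

lemma memLp_interference [IsFiniteMeasure P] (hnet : IsAlohaNetwork lam p ν X T h P)
    (hg : IsPathLoss g) (n : ℕ) (z : Plane) : MemLp (interference g X T h n z) 2 P := by
  have hm := hnet.measurable_extInterference hg n z
  have hfin : ∫⁻ ω, extInterference g X T h n z ω * extInterference g X T h n z ω ∂P ≠ ∞ := by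
    rw [hnet.lintegral_extInterference_mul hg n n z z
      fun i => hnet.lintegral_markWeight_mul_self n i z]
    finiteness
  rw [memLp_two_iff_integrable_sq (hnet.aestronglyMeasurable_interference hg n z)]
  refine (integrable_toReal_of_lintegral_ne_top (hm.mul hm).aemeasurable hfin).congr ?_
  filter_upwards [hnet.ae_summable_and_eq hg n z] with ω hω
  rw [hω.2, sq, Pi.mul_apply, ENNReal.toReal_mul]

lemma integral_interference_mul [IsFiniteMeasure P] (hnet : IsAlohaNetwork lam p ν X T h P)
    (hp : 0 ≤ p) (hg : IsPathLoss g) (n m : ℕ) (u v : Plane) {c : ℝ} (hc0 : 0 ≤ c)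
    (hc : ∀ i, ∫⁻ ω, markWeight T h n u i ω * markWeight T h m v i ω ∂P = ENNReal.ofReal c) :
    ∫ ω, interference g X T h n u ω * interference g X T h m v ω ∂P =
      (p * (lam * ∫ x, g x)) * (p * (lam * ∫ x, g x)) +
        c * (lam * ∫ x, g (x - u) * g (x - v)) := by
  have hmu := hnet.measurable_extInterference hg n u
  have hmv := hnet.measurable_extInterference hg m v
  have hval := hnet.lintegral_extInterference_mul hg n m u v hc
  have hfin : ∫⁻ ω, extInterference g X T h n u ω * extInterference g X T h m v ω ∂P ≠ ∞ := by
    rw [hval]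
    finiteness
  have hae : ∀ᵐ ω ∂P, interference g X T h n u ω * interference g X T h m v ω =
      (extInterference g X T h n u ω * extInterference g X T h m v ω).toReal := by
    filter_upwards [hnet.ae_summable_and_eq hg n u, hnet.ae_summable_and_eq hg m v] with ω hu hv
    rw [hu.2, hv.2, ENNReal.toReal_mul]
  rw [integral_congr_ae hae, integral_toReal
    (f := fun ω => extInterference g X T h n u ω * extInterference g X T h m v ω)
    (hmu.mul hmv).aemeasurable (ae_lt_top (hmu.mul hmv) hfin), hval, ENNReal.toReal_add (by finiteness) (by finiteness)]
  have h1 : 0 ≤ ∫ x, g (x - u) * g (x - v) :=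
    integral_nonneg fun x => mul_nonneg (hg.nonneg _) (hg.nonneg _)
  simp [hp, hc0, h1, integral_nonneg (μ := volume) (f := g) hg.nonneg]
  ring

lemma covariance_interference [IsProbabilityMeasure P] (hnet : IsAlohaNetwork lam p ν X T h P)
    (hp : 0 ≤ p) (hg : IsPathLoss g) (n m : ℕ) (u v : Plane) {c : ℝ} (hc0 : 0 ≤ c)
    (hc : ∀ i, ∫⁻ ω, markWeight T h n u i ω * markWeight T h m v i ω ∂P = ENNReal.ofReal c) :
    cov[interference g X T h n u, interference g X T h m v; P] =
      c * (lam * ∫ x, g (x - u) * g (x - v)) := by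
  rw [covariance_eq_sub (hnet.memLp_interference hg n u) (hnet.memLp_interference hg m v),
    hnet.integral_interference hp hg, hnet.integral_interference hp hg]
  simp only [Pi.mul_apply]
  -- The off-diagonal part cancels against the product of the means.
  rw [hnet.integral_interference_mul hp hg n m u v hc0 hc, add_sub_cancel_left]

lemma covariance_interference_of_ne [IsProbabilityMeasure P]
    (hnet : IsAlohaNetwork lam p ν X T h P) (hp : 0 ≤ p) (hg : IsPathLoss g) {k l : ℕ}
    (hkl : k ≠ l) (u v : Plane) :
    cov[interference g X T h k u, interference g X T h l v; P] =
      p * p * (lam * ∫ x, g x * g (x - EuclideanSpace.single 0 ‖u - v‖)) := by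
  rw [hnet.covariance_interference hp hg k l u v (mul_nonneg hp hp) fun i => ?_,
    hg.integral_mul_comp_sub]
  rw [hnet.lintegral_markWeight_mul_of_ne u v (by simp [hkl]), ENNReal.ofReal_mul hp]

lemma variance_interference [IsProbabilityMeasure P] (hnet : IsAlohaNetwork lam p ν X T h P)
    (hp : 0 ≤ p) (hg : IsPathLoss g) (n : ℕ) (z : Plane) :
    Var[interference g X T h n z; P] = p * (∫ t, t ^ 2 ∂ν) * (lam * ∫ x, g x ^ 2) := by
  have hH : 0 ≤ ∫ t, t ^ 2 ∂ν := integral_nonneg fun t => sq_nonneg t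
  rw [← covariance_self (hnet.aestronglyMeasurable_interference hg n z).aemeasurable,
    hnet.covariance_interference hp hg n n z z (mul_nonneg hp hH) fun i => ?_,
    integral_sub_right_eq_self (fun x => g x * g x) z]
  · simp only [sq]
  · rw [hnet.lintegral_markWeight_mul_self, ENNReal.ofReal_mul hp]

/-- A vanishing second moment would make the fading zero almost surely, against mean one. -/
lemma integral_sq_fading_pos (hnet : IsAlohaNetwork lam p ν X T h P) : 0 < ∫ t, t ^ 2 ∂ν := by
  refine (integral_nonneg fun t => sq_nonneg t).lt_of_ne fun h0 => ?_
  have hz := (integral_eq_zero_iff_of_nonneg (fun t : ℝ => sq_nonneg t) hnet.fading_sq).1 h0.symm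
  have : ∫ t, t ∂ν = 0 := by
    refine integral_eq_zero_of_ae (hz.mono fun t ht => ?_)
    simpa using ht
  rw [hnet.fading_mean] at this
  exact one_ne_zero this

end IsAlohaNetwork

theorem lemma1 {Ω : Type*} [MeasurableSpace Ω] (P : Measure Ω) [IsProbabilityMeasure P]
    (lam : ℝ≥0) (hlam : 0 < lam) (p : ℝ) (hp0 : 0 < p) (hp1 : p ≤ 1) (ν : Measure ℝ)
    (X : ℕ → Ω → Plane) (T : ℕ → ℕ → Ω → Bool) (h : ℕ → Plane → ℕ → Ω → ℝ)
    (hnet : IsAlohaNetwork lam p ν X T h P)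
    (g : Plane → ℝ) (hg : IsPathLoss g) (hg0 : ∃ x, x ≠ 0 ∧ 0 < g x) :
    (∀ (n : ℕ) (z : Plane),
      (∀ᵐ ω ∂P, Summable fun i => interferenceTerm g X T h n z i ω) ∧
      MemLp (interference g X T h n z) 2 P ∧
      0 < Var[interference g X T h n z; P]) ∧
    (Integrable (fun x : Plane => g x ^ 2) ∧ 0 < ∫ x : Plane, g x ^ 2) ∧
    ∀ (k l : ℕ) (u v : Plane), k ≠ l →
      Integrable (fun x : Plane => g x * g (x - EuclideanSpace.single 0 ‖u - v‖)) ∧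
      corrCoeff (interference g X T h k u) (interference g X T h l v) P =
        (p * ∫ x : Plane, g x * g (x - EuclideanSpace.single 0 ‖u - v‖)) /
          ((∫ t, t ^ 2 ∂ν) * ∫ x : Plane, g x ^ 2) := by
  have hG := hg.integral_sq_pos hg0
  have hH := hnet.integral_sq_fading_pos
  have hl : (0 : ℝ) < lam := hlam
  refine ⟨fun n z => ⟨(hnet.ae_summable_and_eq hg n z).mono fun ω hω => hω.1,
    hnet.memLp_interference hg n z, ?_⟩, ⟨hg.integrable_sq, hG⟩, fun k l u v hkl => ⟨?_, ?_⟩⟩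
  · rw [hnet.variance_interference hp0.le hg]
    positivity
  · simpa using hg.integrable_mul_comp_sub 0 (EuclideanSpace.single 0 ‖u - v‖)
  -- The variance is the same at all slots and locations, so the two square roots multiply to it.
  · rw [corrCoeff, hnet.covariance_interference_of_ne hp0.le hg hkl,
      hnet.variance_interference hp0.le hg, hnet.variance_interference hp0.le hg,
      Real.mul_self_sqrt (by positivity)]
    field
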